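/- Let $n\ge 3$ be odd and let $G=SD_{8n}=\langle a,b\mid a^{4n}=b^2=1,\ bab=a^{2n-1}\rangle$ be the semi-dihedral group of order $8n$, regarded as a permutation group on $\mathbb Z/4n$ through the embedding $a\colon t\mapsto t+1$, $b\colon t\mapsto (2n-1)t$. Let $V$ be a complex inner product space of finite dimension $m$. For a character $\chi$ of $G$ let $V^{4n}_\chi(G)\subseteq\bigotimes^{4n}V$ be the symmetry class of tensors, that is, the image of $$T(G,\chi)=\frac{\chi(1)}{|G|}\sum_{\sigma\in G}\chi(\sigma)P_\sigma,\qquad P_\sigma(v_1\otimes\dots\otimes v_{4n})=v_{\sigma^{-1}(1)}\otimes\dots\otimes v_{\sigma^{-1}(4n)}.$$ Let $\chi_0,\dots,\chi_7$ be the linear characters of $G$ whose values at $(a,b)$ are, in this order, $(1,1),(1,-1),(-1,1),(-1,-1),(i,1),(i,-1),(-i,1),(-i,-1)$. With $\omega=e^{i\pi/(2n)}$, let $\rho^h$ be the two-dimensional representation of $G$ with $$\rho^h(a)=\begin{pmatrix}\omega^{h}&0\\0&\omega^{(2n-1)h}\end{pmatrix},\qquad \rho^h(b)=\begin{pmatrix}0&1\\1&0\end{pmatrix};$$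 its character is written $\varsigma_h$ if $h$ is even and $\psi_h$ if $h$ is odd. Put $$E=\{2,4,\dots,2n-2\},\qquad O=\{1,3,\dots,n-2\}\cup\{2n+1,2n+3,\dots,3n-2\},$$ and $\overline S=\{\,s(2n-1)\bmod 4n \mid s\in S\,\}$ (remainders in $\{0,\dots,4n-1\}$) for a set $S$ of integers. Then \begin{align*} \dim V^{4n}_{\chi_0}(G)&=\frac1{8n}\Big[2nm^{n}+nm^{2n}+nm^{2n+2}+\sum_{k=0}^{4n-1}m^{\gcd(4n,k)}\Big],\\ \dim V^{4n}_{\chi_1}(G)&=\frac1{8n}\Big[-2nm^{n}-nm^{2n}-nm^{2n+2}+\sum_{k=0}^{4n-1}m^{\gcd(4n,k)}\Big],\\ \dim V^{4n}_{\chi_2}(G)&=\frac1{8n}\Big[m^{4n}+m^{2n}-2m^{n}+2\sum_{k\in E}m^{\gcd(4n,k)}-\sum_{k\in O\cup\overline{O}}m^{\gcd(4n,k)}-2nm^{n}+nm^{2n}+nm^{2n+2}\Big],\\ \dim V^{4n}_{\chi_3}(G)&=\frac1{8n}\Big[m^{4n}+m^{2n}-2m^{n}+2\sum_{k\in E}m^{\gcd(4n,k)}-\sum_{k\in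 O\cup\overline{O}}m^{\gcd(4n,k)}+2nm^{n}-nm^{2n}-nm^{2n+2}\Big],\\ \dim V^{4n}_{\chi_4}(G)=\dim V^{4n}_{\chi_6}(G)&=\frac1{8n}\Big[m^{4n}-m^{2n}+\sum_{k\in E\cup\overline{E}}(-1)^{k/2}m^{\gcd(4n,k)}+nm^{2n+2}-nm^{2n}\Big],\\ \dim V^{4n}_{\chi_5}(G)=\dim V^{4n}_{\chi_7}(G)&=\frac1{8n}\Big[m^{4n}-m^{2n}+\sum_{k\in E\cup\overline{E}}(-1)^{k/2}m^{\gcd(4n,k)}-nm^{2n+2}+nm^{2n}\Big], \end{align*} for every $h\in E$ $$\dim V^{4n}_{\varsigma_h}(G)=\frac1{2n}\sum_{k=0}^{4n-1}m^{\gcd(4n,k)}\cos\Big(\frac{hk\pi}{2n}\Big),$$ and for every $h'\in O$ $$\dim V^{4n}_{\psi_{h'}}(G)=\frac1{4n}\Big[2m^{4n}-2m^{2n}+4\sum_{k\in E}m^{\gcd(4n,k)}\cos\Big(\frac{h'k\pi}{2n}\Big)\Big].$$ -/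

import Mathlib

open scoped TensorProduct

namespace SemiDihedral

/-- The two generators. -/
inductive Gen : Type
  | a : Gen
  | b : Gen

/-- The relators `a^(4n)`, `b^2` and `b a b (a^(2n-1))⁻¹` (integer exponent). -/
def rels (n : ℕ) : Set (FreeGroup Gen) :=
  {FreeGroup.of Gen.a ^ (4 * n), FreeGroup.of Gen.b ^ 2,
    FreeGroup.of Gen.b * FreeGroup.of Gen.a * FreeGroup.of Gen.b *
      (FreeGroup.of Gen.a ^ (2 * (n : ℤ) - 1))⁻¹}

/-- The semi-dihedral group `SD_{8n} = ⟨a, b ∣ a^(4n) = b^2 = 1, b a b = a^(2n-1)⟩`. -/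
abbrev SD (n : ℕ) : Type := PresentedGroup (rels n)

/-- The generator `a`. -/
def gA (n : ℕ) : SD n := PresentedGroup.of Gen.a

/-- The generator `b`. -/
def gB (n : ℕ) : SD n := PresentedGroup.of Gen.b

/-- The universal property: elements `x`, `y` of a group that satisfy the relations define the
homomorphism with `a ↦ x`, `b ↦ y`. -/
def lift (n : ℕ) {H : Type*} [Group H] (x y : H) (hx : x ^ (4 * n) = 1) (hy : y ^ 2 = 1)
    (hxy : y * x * y = x ^ (2 * (n : ℤ) - 1)) : SD n →* H :=
  PresentedGroup.toGroup (rels := rels n) (f := fun g => Gen.casesOn g x y) (by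
    intro r hr
    rcases hr with rfl | rfl | rfl
    · simpa using hx
    · simpa using hy
    · simp only [map_mul, map_inv, map_zpow, FreeGroup.lift_apply_of]
      rw [hxy, mul_inv_cancel])

theorem lift_a (n : ℕ) {H : Type*} [Group H] (x y : H) (hx : x ^ (4 * n) = 1) (hy : y ^ 2 = 1)
    (hxy : y * x * y = x ^ (2 * (n : ℤ) - 1)) : lift n x y hx hy hxy (gA n) = x := by
  simp [lift, gA]

theorem lift_b (n : ℕ) {H : Type*} [Group H] (x y : H) (hx : x ^ (4 * n) = 1) (hy : y ^ 2 = 1)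
    (hxy : y * x * y = x ^ (2 * (n : ℤ) - 1)) : lift n x y hx hy hxy (gB n) = y := by
  simp [lift, gB]

/-! ### The embedding into the symmetric group on the residues modulo `4n` -/

theorem four_mul_cast (n : ℕ) : (4 : ZMod (4 * n)) * (n : ZMod (4 * n)) = 0 := by
  have h := ZMod.natCast_self (4 * n)
  push_cast at h
  exact h

/-- `T(a)`: the permutation `t ↦ t + 1`. -/
def permA (n : ℕ) : Equiv.Perm (ZMod (4 * n)) := Equiv.addRight 1

/-- `T(b)`: the permutation `t ↦ (2n-1) t`. -/
def permB (n : ℕ) : Equiv.Perm (ZMod (4 * n)) :=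
  Function.Involutive.toPerm (fun t => (2 * (n : ZMod (4 * n)) - 1) * t) (by
    intro t
    linear_combination ((n : ZMod (4 * n)) - 1) * t * four_mul_cast n)

theorem permB_apply (n : ℕ) (t : ZMod (4 * n)) :
    permB n t = (2 * (n : ZMod (4 * n)) - 1) * t := rfl

theorem permA_apply (n : ℕ) (t : ZMod (4 * n)) : permA n t = t + 1 := rfl

theorem permA_zpow (n : ℕ) (k : ℤ) (t : ZMod (4 * n)) : (permA n ^ k) t = t + (k : ℤ) := by
  simp [permA]

/-- The homomorphism `T : SD_{8n} → S_{4n}`. -/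
def embed (n : ℕ) : SD n →* Equiv.Perm (ZMod (4 * n)) :=
  lift n (permA n) (permB n)
    (by
      refine Equiv.ext fun t => ?_
      have h := permA_zpow n ((4 * n : ℕ) : ℤ) t
      rw [zpow_natCast] at h
      rw [h]
      simp [four_mul_cast])
    (by
      refine Equiv.ext fun t => ?_
      rw [sq, Equiv.Perm.mul_apply, permB_apply, permB_apply, Equiv.Perm.one_apply]
      linear_combination ((n : ZMod (4 * n)) - 1) * t * four_mul_cast n)
    (by
      refine Equiv.ext fun t => ?_
      rw [permA_zpow, Equiv.Perm.mul_apply, Equiv.Perm.mul_apply, permB_apply, permB_apply,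
        permA_apply]
      push_cast
      linear_combination ((n : ZMod (4 * n)) - 1) * t * four_mul_cast n)

theorem embed_a (n : ℕ) : embed n (gA n) = permA n := lift_a ..

theorem embed_b (n : ℕ) : embed n (gB n) = permB n := lift_b ..

theorem gA_pow (n : ℕ) : gA n ^ (4 * n) = 1 :=
  PresentedGroup.one_of_mem (rels := rels n) (Or.inl rfl)

theorem gB_pow (n : ℕ) : gB n ^ 2 = 1 :=
  PresentedGroup.one_of_mem (rels := rels n) (Or.inr (Or.inl rfl))

theorem gB_gA_gB (n : ℕ) : gB n * gA n * gB n = gA n ^ (2 * (n : ℤ) - 1) :=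
  mul_inv_eq_one.mp (PresentedGroup.one_of_mem (rels := rels n) (Or.inr (Or.inr rfl)))

/-- Every element is of the form `a^i` or `a^i b`. -/
theorem exists_normal_form (n : ℕ) (g : SD n) :
    ∃ i : ℤ, g = gA n ^ i ∨ g = gA n ^ i * gB n := by
  have hb : gB n * gB n = 1 := by rw [← sq, gB_pow]
  have hbi : (gB n)⁻¹ = gB n := inv_eq_of_mul_eq_one_left hb
  have hba : gB n * gA n = gA n ^ (2 * (n : ℤ) - 1) * gB n := by
    rw [← gB_gA_gB, mul_assoc _ (gB n), hb, mul_one]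
  have hbai : gB n * (gA n)⁻¹ = gA n ^ (-(2 * (n : ℤ) - 1)) * gB n := by
    rw [zpow_neg, ← gB_gA_gB]
    simp [mul_assoc, hbi, hb]
  have hg : g ∈ Subgroup.closure (Set.range (PresentedGroup.of (rels := rels n))) := by
    rw [PresentedGroup.closure_range_of]; trivial
  induction hg using Subgroup.closure_induction_right with
  | one => exact ⟨0, Or.inl (by simp)⟩
  | mul_right x _ y hy ih =>
    obtain ⟨i, rfl | rfl⟩ := ih
    · rcases hy with ⟨_ | _, rfl⟩
      · exact ⟨i + 1, Or.inl (zpow_add_one (gA n) i).symm⟩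
      · exact ⟨i, Or.inr rfl⟩
    · rcases hy with ⟨_ | _, rfl⟩
      · exact ⟨i + (2 * (n : ℤ) - 1), Or.inr (by
          change gA n ^ i * gB n * gA n = _
          rw [mul_assoc, hba, zpow_add, mul_assoc])⟩
      · exact ⟨i, Or.inl (by
          change gA n ^ i * gB n * gB n = _
          rw [mul_assoc, hb, mul_one])⟩
  | mul_inv_cancel x _ y hy ih =>
    obtain ⟨i, rfl | rfl⟩ := ih
    · rcases hy with ⟨_ | _, rfl⟩
      · exact ⟨i - 1, Or.inl (zpow_sub_one (gA n) i).symm⟩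
      · exact ⟨i, Or.inr (by
          change gA n ^ i * (gB n)⁻¹ = _
          rw [hbi])⟩
    · rcases hy with ⟨_ | _, rfl⟩
      · exact ⟨i + -(2 * (n : ℤ) - 1), Or.inr (by
          change gA n ^ i * gB n * (gA n)⁻¹ = _
          rw [mul_assoc, hbai, zpow_add, mul_assoc])⟩
      · exact ⟨i, Or.inl (by
          change gA n ^ i * gB n * (gB n)⁻¹ = _
          rw [mul_inv_cancel_right])⟩

/-- For `n ≥ 2` the homomorphism `T` is injective, so that `SD_{8n}` is a permutation group. -/
theorem embed_injective (n : ℕ) (hn : 2 ≤ n) : Function.Injective (embed n) := by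
  rw [injective_iff_map_eq_one]
  intro g hg
  have key : ∀ i : ℤ, (i : ZMod (4 * n)) = 0 → gA n ^ i = 1 := by
    intro i hi
    obtain ⟨k, rfl⟩ := (ZMod.intCast_zmod_eq_zero_iff_dvd i (4 * n)).mp hi
    rw [zpow_mul, zpow_natCast, gA_pow, one_zpow]
  obtain ⟨i, rfl | rfl⟩ := exists_normal_form n g
  · have h := congrArg (fun s : Equiv.Perm (ZMod (4 * n)) => s 0) hg
    simp only [map_zpow, embed_a, permA_zpow, Equiv.Perm.one_apply, zero_add] at h
    exact key i h
  · have h := congrArg (fun s : Equiv.Perm (ZMod (4 * n)) => s 0) hg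
    simp only [map_mul, map_zpow, embed_a, embed_b, Equiv.Perm.mul_apply, permB_apply, permA_zpow,
      Equiv.Perm.one_apply, mul_zero, zero_add] at h
    rw [key i h, one_mul, embed_b] at hg
    have h1 := congrArg (fun s : Equiv.Perm (ZMod (4 * n)) => s 1) hg
    simp only [permB_apply, Equiv.Perm.one_apply, mul_one] at h1
    have h2 : ((2 * n - 2 : ℕ) : ZMod (4 * n)) = 0 := by
      rw [Nat.cast_sub (by omega)]
      push_cast
      linear_combination h1
    have h3 := Nat.le_of_dvd (by omega) ((ZMod.natCast_eq_zero_iff _ _).mp h2)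
    omega

theorem finite_SD (n : ℕ) (hn : 2 ≤ n) : Finite (SD n) := by
  have : NeZero (4 * n) := ⟨by omega⟩
  exact Finite.of_injective _ (embed_injective n hn)

/-! ### The characters -/

/-- For odd `n`, the linear character with `a ↦ α`, `b ↦ β`, where `α^4 = β^2 = 1`. -/
def linChar (n : ℕ) (hn : Odd n) (α β : ℂˣ) (hα : α ^ 4 = 1) (hβ : β ^ 2 = 1) : SD n → ℂ :=
  fun g => (lift n α β (by rw [pow_mul, hα, one_pow]) hβ (by
    obtain ⟨k, rfl⟩ := hn
    have h1 : (2 * ((2 * k + 1 : ℕ) : ℤ) - 1) = ((4 * k + 1 : ℕ) : ℤ) := by push_cast; ring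
    rw [h1, zpow_natCast, pow_succ, pow_mul, hα, one_pow, one_mul, mul_right_comm, ← sq, hβ,
      one_mul]) g : ℂˣ)

/-- The imaginary unit as a unit of `ℂ`. -/
noncomputable def unitI : ℂˣ := Units.mk0 Complex.I Complex.I_ne_zero

theorem unitI_pow : unitI ^ 4 = 1 := by
  ext; simp [unitI]

theorem neg_unitI_pow : (-unitI) ^ 4 = 1 := by
  rw [Even.neg_pow (by decide), unitI_pow]

theorem neg_one_pow_four : (-1 : ℂˣ) ^ 4 = 1 := by simp [Even.neg_pow (by decide : Even 4)]

theorem neg_one_pow_two : (-1 : ℂˣ) ^ 2 = 1 := by simp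

/-- `a ↦ 1`, `b ↦ 1`. -/
def chi0 (n : ℕ) (hn : Odd n) : SD n → ℂ :=
  linChar n hn 1 1 (one_pow 4) (one_pow 2)

/-- `a ↦ 1`, `b ↦ -1`. -/
def chi1 (n : ℕ) (hn : Odd n) : SD n → ℂ :=
  linChar n hn 1 (-1) (one_pow 4) neg_one_pow_two

/-- `a ↦ -1`, `b ↦ 1`. -/
def chi2 (n : ℕ) (hn : Odd n) : SD n → ℂ :=
  linChar n hn (-1) 1 neg_one_pow_four (one_pow 2)

/-- `a ↦ -1`, `b ↦ -1`. -/
def chi3 (n : ℕ) (hn : Odd n) : SD n → ℂ :=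
  linChar n hn (-1) (-1) neg_one_pow_four neg_one_pow_two

/-- `a ↦ i`, `b ↦ 1`. -/
noncomputable def chi4 (n : ℕ) (hn : Odd n) : SD n → ℂ :=
  linChar n hn unitI 1 unitI_pow (one_pow 2)

/-- `a ↦ i`, `b ↦ -1`. -/
noncomputable def chi5 (n : ℕ) (hn : Odd n) : SD n → ℂ :=
  linChar n hn unitI (-1) unitI_pow neg_one_pow_two

/-- `a ↦ -i`, `b ↦ 1`. -/
noncomputable def chi6 (n : ℕ) (hn : Odd n) : SD n → ℂ :=
  linChar n hn (-unitI) 1 neg_unitI_pow (one_pow 2)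

/-- `a ↦ -i`, `b ↦ -1`. -/
noncomputable def chi7 (n : ℕ) (hn : Odd n) : SD n → ℂ :=
  linChar n hn (-unitI) (-1) neg_unitI_pow neg_one_pow_two

/-- `ω = e^{iπ/(2n)}`. -/
noncomputable def omega (n : ℕ) : ℂ := Complex.exp (Complex.I * Real.pi / (2 * n))

theorem omega_ne_zero (n : ℕ) : omega n ≠ 0 := Complex.exp_ne_zero _

theorem omega_zpow (n : ℕ) (k : ℤ) : omega n ^ (4 * (n : ℤ) * k) = 1 := by
  rcases Nat.eq_zero_or_pos n with rfl | h
  · simp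
  · have h0 : (n : ℂ) ≠ 0 := by exact_mod_cast h.ne'
    rw [zpow_mul]
    have : omega n ^ (4 * (n : ℤ)) = 1 := by
      rw [omega, ← Complex.exp_int_mul, ← Complex.exp_two_pi_mul_I]
      congr 1
      push_cast
      field_simp
      ring
    rw [this, one_zpow]

theorem omega_pow (n : ℕ) : omega n ^ (4 * n) = 1 := by
  have h := omega_zpow n 1
  rw [mul_one] at h
  exact_mod_cast h

/-- `ω` as a unit of `ℂ`. -/
noncomputable def omegaU (n : ℕ) : ℂˣ := Units.mk0 (omega n) (omega_ne_zero n)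

theorem omegaU_zpow (n : ℕ) (k : ℤ) : omegaU n ^ (4 * (n : ℤ) * k) = 1 := by
  ext
  simpa [omegaU] using omega_zpow n k

/-- The invertible diagonal matrix `diag(x, y)`. -/
noncomputable def diagU (x y : ℂˣ) : GL (Fin 2) ℂ where
  val := !![(x : ℂ), 0; 0, (y : ℂ)]
  inv := !![((x⁻¹ : ℂˣ) : ℂ), 0; 0, ((y⁻¹ : ℂˣ) : ℂ)]
  val_inv := by simp [Matrix.one_fin_two]
  inv_val := by simp [Matrix.one_fin_two]

theorem diagU_mul (x y x' y' : ℂˣ) : diagU x y * diagU x' y' = diagU (x * x') (y * y') := by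
  apply Units.ext
  simp [diagU]

theorem diagU_one : diagU 1 1 = 1 := by
  apply Units.ext
  simp [diagU, Matrix.one_fin_two]

theorem diagU_zpow (x y : ℂˣ) (k : ℤ) : diagU x y ^ k = diagU (x ^ k) (y ^ k) := by
  let f : ℂˣ × ℂˣ →* GL (Fin 2) ℂ :=
    { toFun := fun p => diagU p.1 p.2
      map_one' := diagU_one
      map_mul' := fun p q => (diagU_mul p.1 p.2 q.1 q.2).symm }
  exact (map_zpow f (x, y) k).symm

/-- The invertible matrix that exchanges the two basis vectors. -/
def swapU : GL (Fin 2) ℂ where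
  val := !![0, 1; 1, 0]
  inv := !![0, 1; 1, 0]
  val_inv := by simp [Matrix.one_fin_two]
  inv_val := by simp [Matrix.one_fin_two]

theorem swapU_sq : swapU ^ 2 = 1 := by
  apply Units.ext
  simp [swapU, sq, Matrix.one_fin_two]

theorem swapU_conj (x y : ℂˣ) : swapU * diagU x y * swapU = diagU y x := by
  apply Units.ext
  simp [swapU, diagU]

/-- The two-dimensional representation `ρ^h` of `SD_{8n}`, with
`ρ^h(a) = diag(ω^h, ω^{(2n-1)h})` and `ρ^h(b)` the exchange matrix. -/
noncomputable def rho (n h : ℕ) : SD n →* GL (Fin 2) ℂ :=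
  lift n (diagU (omegaU n ^ (h : ℤ)) (omegaU n ^ ((2 * (n : ℤ) - 1) * h))) swapU
    (by
      rw [← zpow_natCast, diagU_zpow, ← zpow_mul, ← zpow_mul, ← diagU_one]
      push_cast
      congr 1
      · rw [mul_comm, omegaU_zpow]
      · rw [mul_comm, omegaU_zpow])
    swapU_sq
    (by
      rw [swapU_conj, diagU_zpow, ← zpow_mul, ← zpow_mul]
      congr 1
      · rw [mul_comm]
      · have : (2 * (n : ℤ) - 1) * h * (2 * (n : ℤ) - 1)
            = h + 4 * (n : ℤ) * ((n - 1) * h) := by ring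
        rw [this, zpow_add, omegaU_zpow, mul_one])

/-- The character of `ρ^h`. It is written `ς_h` for even `h` and `ψ_h` for odd `h`. -/
noncomputable def rhoChar (n h : ℕ) : SD n → ℂ :=
  fun g => Matrix.trace ((rho n h g : GL (Fin 2) ℂ) : Matrix (Fin 2) (Fin 2) ℂ)

/-- On `a^r` the character of `ρ^h` has the value `ω^{hr} + ω^{(2n-1)hr}`. -/
theorem rhoChar_a_zpow (n h : ℕ) (r : ℤ) : rhoChar n h (gA n ^ r) =
    omega n ^ ((h : ℤ) * r) + omega n ^ ((2 * (n : ℤ) - 1) * h * r) := by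
  rw [rhoChar, map_zpow, rho, lift_a, diagU_zpow, ← zpow_mul, ← zpow_mul]
  simp [diagU, Matrix.trace_fin_two, omegaU]

/-- The character of `ρ^h` vanishes on `a^r b`. -/
theorem rhoChar_a_zpow_b (n h : ℕ) (r : ℤ) : rhoChar n h (gA n ^ r * gB n) = 0 := by
  rw [rhoChar, map_mul, map_zpow, rho, lift_a, lift_b, diagU_zpow]
  simp [diagU, swapU, Matrix.trace_fin_two]

/-! ### Symmetry classes of tensors -/

/-- The operator `P_σ` on `⨂ V`, with
`P_σ (⨂ₜ i, v i) = ⨂ₜ i, v (σ⁻¹ i)`. -/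
noncomputable def permOp {ι : Type*} (V : Type*) [AddCommGroup V] [Module ℂ V]
    (σ : Equiv.Perm ι) : (⨂[ℂ] _ : ι, V) →ₗ[ℂ] (⨂[ℂ] _ : ι, V) :=
  (PiTensorProduct.reindex ℂ (fun _ : ι => V) σ).toLinearMap

theorem permOp_tprod {ι : Type*} (V : Type*) [AddCommGroup V] [Module ℂ V]
    (σ : Equiv.Perm ι) (v : ι → V) :
    permOp V σ (PiTensorProduct.tprod ℂ v) = PiTensorProduct.tprod ℂ (fun i => v (σ⁻¹ i)) :=
  PiTensorProduct.reindex_tprod σ v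

/-- The symmetry operator `T(G,χ) = (χ(1)/|G|) ∑_{g ∈ G} χ(g) P_g`, for a finite group `G` that
acts on the positions `ι` through `φ`. -/
noncomputable def symmetrizer {G : Type*} [Group G] {ι : Type*} (φ : G →* Equiv.Perm ι)
    (χ : G → ℂ) (V : Type*) [AddCommGroup V] [Module ℂ V] :
    (⨂[ℂ] _ : ι, V) →ₗ[ℂ] (⨂[ℂ] _ : ι, V) :=
  (χ 1 / (Nat.card G : ℂ)) • ∑ᶠ g : G, χ g • permOp V (φ g)

/-- The symmetry class of tensors: the image of the symmetry operator. -/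
noncomputable def symmetryClass {G : Type*} [Group G] {ι : Type*} (φ : G →* Equiv.Perm ι)
    (χ : G → ℂ) (V : Type*) [AddCommGroup V] [Module ℂ V] : Submodule ℂ (⨂[ℂ] _ : ι, V) :=
  LinearMap.range (symmetrizer φ χ V)

/-- `dim V^{4n}_χ(SD_{8n})`. -/
noncomputable def dimClass (n : ℕ) (V : Type*) [AddCommGroup V] [Module ℂ V] (χ : SD n → ℂ) : ℕ :=
  Module.finrank ℂ (symmetryClass (embed n) χ V)

/-! ### The index sets -/

/-- `{0, 2, 4, …, 2n}`. -/
def C1 (n : ℕ) : Finset ℕ := {k ∈ Finset.Icc 0 (2 * n) | Even k}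

/-- `{2, 4, …, 2n-2}`. -/
def CdagEven (n : ℕ) : Finset ℕ := C1 n \ {0, 2 * n}

/-- For odd `n`: `{1, 3, …, n} ∪ {2n+1, 2n+3, …, 3n}`. -/
def Codd23 (n : ℕ) : Finset ℕ :=
  {k ∈ Finset.Icc 1 n ∪ Finset.Icc (2 * n + 1) (3 * n) | Odd k}

/-- The odd numbers in `[1, n-1] ∪ [2n+1, 3n-1]`. -/
def CdagOdd (n : ℕ) : Finset ℕ :=
  {k ∈ Finset.Icc 1 (n - 1) ∪ Finset.Icc (2 * n + 1) (3 * n - 1) | Odd k}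

/-- `S ↦ {s (2n-1) mod 4n ∣ s ∈ S}`. -/
def bar (n : ℕ) (S : Finset ℕ) : Finset ℕ := S.image (fun s => s * (2 * n - 1) % (4 * n))

end SemiDihedral

open scoped TensorProduct

namespace SemiDihedral

/-! The convolution identity `χ 1 * ∑ x, χ x * χ (x⁻¹ * g) = |G| * χ g` makes the symmetrizer
idempotent, so the dimension of its image is its trace (`finrank_symmetryClass`). The trace of `P_σ`
in a tensor basis is `m` to the number of cycles of `σ`, and the dimension becomes a weighted sum of
powers of `m` over the group (`dimClass_eq`).

Cycles are counted with Burnside's lemma for a cyclic group. The translation `a^k` has `gcd(4n, k)`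
cycles. The map `a^k b : t ↦ (2n-1)t + k` has as its square the translation by `2nk`, and it has
four fixed points if `4 ∣ k` and none otherwise; this gives `2n+2`, `2n` or `n` cycles according to
`k` modulo 4.

What remains is to evaluate the character sums. On the coset of `b` a linear character has period 4
in `k`, and a two-dimensional one vanishes. On the powers of `a` the sum is split by the parity of
`k`, and the symmetry `k ↦ 4n - k`, which preserves the gcd, either pairs equal terms or cancels
them. -/

/-! ### Dimensions as traces of idempotents -/

theorem permOp_mul {ι : Type*} (V : Type*) [AddCommGroup V] [Module ℂ V] (σ τ : Equiv.Perm ι) :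
    permOp V (σ * τ) = permOp V σ * permOp V τ := by
  refine PiTensorProduct.ext (MultilinearMap.ext fun v => ?_)
  simp [permOp_tprod]

/-- The symmetrizer of `χ` is idempotent if `χ` satisfies the convolution identity of an
irreducible character. -/
theorem isIdempotentElem_symmetrizer {G : Type*} [Group G] [Fintype G] {ι : Type*}
    (φ : G →* Equiv.Perm ι) (χ : G → ℂ) (V : Type*) [AddCommGroup V] [Module ℂ V]
    (h : ∀ g, χ 1 * ∑ x, χ x * χ (x⁻¹ * g) = Nat.card G * χ g) :
    IsIdempotentElem (symmetrizer φ χ V) := by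
  have hG : (Nat.card G : ℂ) ≠ 0 := by exact_mod_cast Nat.card_pos.ne'
  have hsq : (∑ x, χ x • permOp V (φ x)) * (∑ y, χ y • permOp V (φ y)) =
      ∑ g, (∑ x, χ x * χ (x⁻¹ * g)) • permOp V (φ g) := by
    rw [Finset.sum_mul_sum]
    simp_rw [Finset.sum_smul]
    rw [Finset.sum_comm (s := Finset.univ) (t := Finset.univ)
      (f := fun g x => (χ x * χ (x⁻¹ * g)) • permOp V (φ g))]
    -- For fixed `x` the substitution `g = x * y` turns the double sum into a convolution.
    refine Finset.sum_congr rfl fun x _ => ?_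
    refine Fintype.sum_equiv (Equiv.mulLeft x) _ _ fun y => ?_
    simp [permOp_mul, smul_smul, mul_comm]
  rw [IsIdempotentElem, symmetrizer, finsum_eq_sum_of_fintype, smul_mul_smul_comm, hsq,
    Finset.smul_sum, Finset.smul_sum]
  refine Finset.sum_congr rfl fun g _ => ?_
  rw [smul_smul, smul_smul]
  congr 1
  field_simp
  linear_combination (χ 1) * h g

theorem finrank_symmetryClass {G : Type*} [Group G] [Fintype G] {ι : Type*} [Finite ι]
    (φ : G →* Equiv.Perm ι) (χ : G → ℂ) (V : Type*) [AddCommGroup V] [Module ℂ V]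
    [FiniteDimensional ℂ V]
    (h : ∀ g, χ 1 * ∑ x, χ x * χ (x⁻¹ * g) = Nat.card G * χ g) :
    (Module.finrank ℂ (symmetryClass φ χ V) : ℂ) =
      χ 1 / Nat.card G * ∑ g, χ g * LinearMap.trace ℂ _ (permOp V (φ g)) := by
  have : FiniteDimensional ℂ (⨂[ℂ] _ : ι, V) :=
    Module.Finite.of_basis (Basis.piTensorProduct fun _ => Module.finBasis ℂ V)
  have hp := LinearMap.IsIdempotentElem.isProj_range _ (isIdempotentElem_symmetrizer φ χ V h)
  rw [symmetryClass, ← hp.trace, symmetrizer, finsum_eq_sum_of_fintype]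
  simp [map_sum]

/-- The trace of `P_σ` counts the colourings of the positions that are invariant under `σ`. -/
theorem trace_permOp {ι : Type*} [Finite ι] (V : Type*) [AddCommGroup V] [Module ℂ V]
    [FiniteDimensional ℂ V] (σ : Equiv.Perm ι) :
    LinearMap.trace ℂ _ (permOp V σ) =
      (Nat.card {f : ι → Fin (Module.finrank ℂ V) // ∀ i, f (σ i) = f i} : ℂ) := by
  classical
  have := Fintype.ofFinite ι
  let b := Module.finBasis ℂ V
  rw [LinearMap.trace_eq_matrix_trace ℂ (Basis.piTensorProduct fun _ : ι => b), Matrix.trace,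
    Nat.card_eq_fintype_card, Fintype.card_subtype, Finset.card_filter, Nat.cast_sum]
  refine Finset.sum_congr rfl fun f _ => ?_
  rw [Matrix.diag_apply, LinearMap.toMatrix_apply, Basis.piTensorProduct_apply, permOp_tprod,
    Basis.piTensorProduct_repr_tprod_apply]
  simp only [Module.Basis.repr_self, Finsupp.single_apply]
  rw [Fintype.prod_ite_zero]
  have : (∀ i, f (σ⁻¹ i) = f i) ↔ ∀ i, f (σ i) = f i :=
    ⟨fun h i => by simpa using (h (σ i)).symm, fun h i => by simpa using (h (σ⁻¹ i)).symm⟩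
  simp only [this, Finset.prod_const_one, Nat.cast_ite, Nat.cast_one, Nat.cast_zero]

/-! ### Counting cycles with Burnside's lemma -/

theorem sum_zmod {M : Type*} [AddCommMonoid M] (N : ℕ) [NeZero N] (f : ZMod N → M) :
    ∑ t, f t = ∑ i ∈ Finset.range N, f i := by
  refine Finset.sum_nbij' ZMod.val (fun i => (i : ZMod N)) ?_ ?_ ?_ ?_ ?_
  · intro a _; simpa using ZMod.val_lt a
  · simp
  · simp
  · intro a ha; exact ZMod.val_cast_of_lt (by simpa using ha)
  · simp

/-- By Burnside's lemma, a permutation `σ` with `σ ^ d = 1` whose first `d` powers have `c * d`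
fixed points in total has `c` orbits. -/
theorem card_invariant_functions {ι κ : Type*} [Fintype ι] [DecidableEq ι] [Finite κ]
    (σ : Equiv.Perm ι) (d c : ℕ) [NeZero d] (hd : σ ^ d = 1)
    (hc : ∑ i ∈ Finset.range d, Finset.card {t | (σ ^ i) t = t} = c * d) :
    Nat.card {f : ι → κ // ∀ i, f (σ i) = f i} = Nat.card κ ^ c := by
  classical
  -- The acting group is `ZMod d` rather than the group generated by `σ`: it has exactly `d`
  -- elements even if the order of `σ` is a proper divisor of `d`.
  let φ : Multiplicative (ZMod d) →* Equiv.Perm ι :=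
    AddMonoidHom.toMultiplicativeLeft (ZMod.lift d ⟨zmultiplesHom _ (Additive.ofMul σ), by
      simp [← ofMul_pow, hd]⟩)
  have hφ : ∀ i : ℕ, φ (Multiplicative.ofAdd (i : ZMod d)) = σ ^ i := by
    intro i
    have : ((i : ℤ) : ZMod d) = i := by simp
    rw [← this]
    simp only [φ, AddMonoidHom.toMultiplicativeLeft_apply_apply, toAdd_ofAdd, ZMod.lift_coe]
    simp
  let _ : MulAction (Multiplicative (ZMod d)) ι := MulAction.compHom ι φ
  have hsm : ∀ (g : Multiplicative (ZMod d)) (t : ι), g • t = φ g t := fun _ _ => rfl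
  have hB := MulAction.sum_card_fixedBy_eq_card_orbits_mul_card_group (Multiplicative (ZMod d)) ι
  have hL : ∑ g : Multiplicative (ZMod d), Fintype.card (MulAction.fixedBy ι g) = c * d := by
    rw [← hc]
    have := sum_zmod d fun t => Fintype.card (MulAction.fixedBy ι (Multiplicative.ofAdd t))
    refine (Fintype.sum_equiv Multiplicative.toAdd _ _ fun _ => rfl).trans (this.trans ?_)
    refine Finset.sum_congr rfl fun i _ => ?_
    rw [Fintype.card_subtype]
    congr 1
    ext t
    simp [MulAction.mem_fixedBy, hsm, hφ]
  rw [hL] at hB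
  have hcard : Fintype.card (MulAction.orbitRel.Quotient (Multiplicative (ZMod d)) ι) = c := by
    rw [Fintype.card_multiplicative, ZMod.card] at hB
    exact (Nat.eq_of_mul_eq_mul_right (NeZero.pos d) hB).symm
  rw [← hcard, ← Nat.card_eq_fintype_card, ← Nat.card_fun]
  -- Invariant functions are the functions on the orbit space.
  refine Nat.card_congr ⟨fun f => Quotient.lift f.1 ?_, fun F => ⟨fun t => F ⟦t⟧, ?_⟩, ?_, ?_⟩
  · rintro x y ⟨g, rfl⟩
    obtain ⟨i, rfl⟩ : ∃ i : ℕ, Multiplicative.ofAdd (i : ZMod d) = g :=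
      ⟨ZMod.val g.toAdd, by simp⟩
    change f.1 (φ _ y) = f.1 y
    rw [hφ]
    induction i with
    | zero => simp
    | succ i ih => rw [pow_succ', Equiv.Perm.mul_apply, f.2, ih]
  · intro i
    refine congrArg F (Quotient.sound ⟨Multiplicative.ofAdd ((1 : ℕ) : ZMod d), ?_⟩)
    change φ _ i = σ i
    rw [hφ, pow_one]
  · intro f; rfl
  · intro F
    funext q
    induction q using Quotient.inductionOn
    rfl

/-! ### Cycles of `a^k` and `a^k b` -/

theorem embed_a_pow (n k : ℕ) (t : ZMod (4 * n)) : embed n (gA n ^ k) t = t + k := by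
  rw [map_pow, embed_a]
  simpa using permA_zpow n k t

theorem embed_a_pow_b (n k : ℕ) (t : ZMod (4 * n)) :
    embed n (gA n ^ k * gB n) t = (2 * (n : ZMod (4 * n)) - 1) * t + k := by
  rw [map_mul, Equiv.Perm.mul_apply, embed_a_pow, embed_b, permB_apply]

/-- With `g` the gcd and `N = g N'`, the condition says that `N'` divides `i`, and there are `g`
multiples of `N'` below `N`. This is the Burnside count for a translation by `k`. -/
theorem card_dvd_mul (N k : ℕ) (hN : 0 < N) :
    Finset.card {i ∈ Finset.range N | N ∣ i * k} = Nat.gcd N k := by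
  obtain ⟨g, hg⟩ : ∃ g, g = Nat.gcd N k := ⟨_, rfl⟩
  have hg0 : 0 < g := hg ▸ Nat.gcd_pos_of_pos_left k hN
  obtain ⟨N', hN'⟩ : g ∣ N := hg ▸ Nat.gcd_dvd_left N k
  obtain ⟨k', hk'⟩ : g ∣ k := hg ▸ Nat.gcd_dvd_right N k
  have hcop : Nat.Coprime N' k' := by
    have h := Nat.gcd_mul_left g N' k'
    rw [← hN', ← hk', ← hg] at h
    exact Nat.eq_of_mul_eq_mul_left hg0 (by rw [← h, mul_one])
  have hN0 : 0 < N' := Nat.pos_of_ne_zero (by rintro rfl; omega)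
  rw [← hg]
  have hiff : ∀ i, N ∣ i * k ↔ i ≡ 0 [MOD N'] := by
    intro i
    rw [Nat.modEq_zero_iff_dvd, hN', hk', mul_left_comm, Nat.mul_dvd_mul_iff_left hg0]
    exact ⟨fun h => hcop.dvd_of_dvd_mul_right h, fun h => h.mul_right _⟩
  simp_rw [hiff]
  rw [← Nat.count_eq_card_filter_range, Nat.count_modEq_card _ hN0]
  rw [hN', Nat.mul_div_cancel _ hN0]
  simp

theorem filter_card_zmod (N : ℕ) [NeZero N] (p : ZMod N → Prop) [DecidablePred p] :
    Finset.card {t | p t} = Finset.card {i ∈ Finset.range N | p (i : ℕ)} := by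
  rw [Finset.card_filter, sum_zmod, ← Finset.card_filter]

theorem card_invariant_a (n k : ℕ) [NeZero n] (κ : Type*) [Finite κ] :
    Nat.card {f : ZMod (4 * n) → κ // ∀ i, f (embed n (gA n ^ k) i) = f i} =
      Nat.card κ ^ Nat.gcd (4 * n) k := by
  have hpow : ∀ i : ℕ, embed n (gA n ^ k) ^ i = embed n (gA n ^ (i * k)) := by
    intro i; rw [← map_pow, ← pow_mul, mul_comm k i]
  refine card_invariant_functions _ (4 * n) _ ?_ ?_
  · rw [hpow, pow_mul, gA_pow, one_pow, map_one]
  · rw [← card_dvd_mul (4 * n) k (NeZero.pos _), Finset.card_filter, Finset.sum_mul]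
    refine Finset.sum_congr rfl fun i _ => ?_
    -- A translation fixes every point or none.
    simp only [hpow, embed_a_pow, add_eq_left, ZMod.natCast_eq_zero_iff]
    split_ifs with h <;> simp [h, ZMod.card]

/-- The multiplier satisfies `(2n-1)^2 = 1` modulo `4n`, and the shifts add up to `(2n-1)k + k =
2nk`. -/
theorem embed_a_pow_b_sq (n k : ℕ) (t : ZMod (4 * n)) :
    (embed n (gA n ^ k * gB n) ^ 2) t = t + (2 * n * k : ℕ) := by
  rw [sq, Equiv.Perm.mul_apply, embed_a_pow_b, embed_a_pow_b]
  push_cast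
  linear_combination ((n : ZMod (4 * n)) - 1) * t * four_mul_cast n

theorem embed_a_pow_b_fixed_iff (n k i : ℕ) [NeZero n] :
    embed n (gA n ^ k * gB n) (i : ZMod (4 * n)) = i ↔ 4 * n ∣ 2 * (n - 1) * i + k := by
  rw [embed_a_pow_b, ← ZMod.natCast_eq_zero_iff, ← sub_eq_zero]
  push_cast [Nat.cast_sub (NeZero.one_le (n := n))]
  constructor <;> intro h <;> linear_combination h

/-- The number of orbits of `a ^ k * b` on the residues modulo `4 * n`. -/
def orbitsAB (n k : ℕ) : ℕ := if k % 4 = 0 then 2 * n + 2 else if k % 2 = 0 then 2 * n else n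

/-- With `n = 2j + 1` and `k = 4s` a fixed point solves `j i + s ≡ 0` modulo `n`. Since `2j ≡ -1`,
doubling gives the single class `i ≡ 2s`, which has four representatives below `4n`. -/
theorem card_fixed_a_pow_b (n k : ℕ) (hn : Odd n) [NeZero n] :
    Finset.card {t | embed n (gA n ^ k * gB n) t = t} = if k % 4 = 0 then 4 else 0 := by
  obtain ⟨j, hj⟩ := hn
  rw [filter_card_zmod]
  simp_rw [embed_a_pow_b_fixed_iff]
  have h2 : 2 * (n - 1) = 4 * j := by omega
  rw [h2]
  split_ifs with hk
  · obtain ⟨s, rfl⟩ : 4 ∣ k := Nat.dvd_of_mod_eq_zero hk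
    have hiff : ∀ i, 4 * n ∣ 4 * j * i + 4 * s ↔ i ≡ 2 * s [MOD n] := by
      intro i
      rw [mul_assoc, ← mul_add, Nat.mul_dvd_mul_iff_left (by norm_num), ← Int.natCast_dvd_natCast,
        ← Int.natCast_modEq_iff, Int.modEq_iff_dvd, hj]
      push_cast
      constructor
      · rintro ⟨c, hc⟩
        exact ⟨2 * c - i, by linear_combination 2 * hc⟩
      · rintro ⟨c, hc⟩
        exact ⟨s - j * c, by linear_combination (-(j : ℤ)) * hc⟩
    simp_rw [hiff]
    rw [← Nat.count_eq_card_filter_range, Nat.count_modEq_card _ (NeZero.pos n),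
      Nat.mul_div_cancel _ (NeZero.pos n)]
    simp
  · rw [Finset.card_eq_zero, Finset.filter_eq_empty_iff]
    intro i _ h
    have h4 : 4 ∣ 4 * (j * i) + k := by
      rw [← mul_assoc]; exact (Dvd.intro _ rfl).trans h
    omega

/-- For even `k` the permutation squares to the identity, so Burnside averages `4n` with 4 or 0
fixed points. For odd `k` its square is the translation by `2n`; only the identity among the first
four powers has fixed points, so all cycles have length 4. -/
theorem card_invariant_ab (n k : ℕ) (hn : Odd n) [NeZero n] (κ : Type*) [Finite κ] :
    Nat.card {f : ZMod (4 * n) → κ // ∀ i, f (embed n (gA n ^ k * gB n) i) = f i} =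
      Nat.card κ ^ orbitsAB n k := by
  have hfix := card_fixed_a_pow_b n k hn
  rcases Nat.even_or_odd' k with ⟨l, rfl | rfl⟩
  · have hsq : embed n (gA n ^ (2 * l) * gB n) ^ 2 = 1 := by
      refine Equiv.ext fun t => ?_
      rw [embed_a_pow_b_sq]
      have : ((2 * n * (2 * l) : ℕ) : ZMod (4 * n)) = 0 := by
        push_cast; linear_combination (l : ZMod (4 * n)) * four_mul_cast n
      rw [this, add_zero, Equiv.Perm.one_apply]
    refine card_invariant_functions _ 2 _ hsq ?_
    simp only [Finset.sum_range_succ, Finset.sum_range_zero, pow_zero, pow_one, hfix, orbitsAB]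
    simp only [Equiv.Perm.one_apply, Finset.filter_true, Finset.card_univ, ZMod.card]
    split_ifs <;> omega
  · have h2 : ((2 * n * (2 * l + 1) : ℕ) : ZMod (4 * n)) = (2 * n : ℕ) := by
      push_cast; linear_combination (l : ZMod (4 * n)) * four_mul_cast n
    have hsq : ∀ t, (embed n (gA n ^ (2 * l + 1) * gB n) ^ 2) t = t + (2 * n : ℕ) := by
      intro t; rw [embed_a_pow_b_sq, h2]
    have h20 : ((2 * n : ℕ) : ZMod (4 * n)) ≠ 0 := by
      rw [Ne, ZMod.natCast_eq_zero_iff]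
      intro h
      have := Nat.le_of_dvd (by have := NeZero.pos n; omega) h
      have := NeZero.pos n
      omega
    have h4 : embed n (gA n ^ (2 * l + 1) * gB n) ^ 4 = 1 := by
      refine Equiv.ext fun t => ?_
      rw [pow_add _ 2 2, Equiv.Perm.mul_apply, hsq, hsq, Equiv.Perm.one_apply]
      push_cast
      linear_combination four_mul_cast n
    -- The cube is the inverse, hence has the same fixed points.
    have h3 : ∀ t, (embed n (gA n ^ (2 * l + 1) * gB n) ^ 3) t = t ↔
        embed n (gA n ^ (2 * l + 1) * gB n) t = t := by
      intro t
      have h := congrArg (fun s => s t) h4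
      simp only [Equiv.Perm.one_apply, pow_succ' _ 3, Equiv.Perm.mul_apply] at h
      constructor
      · intro h'; rwa [h'] at h
      · intro h'; exact Equiv.Perm.pow_apply_eq_self_of_apply_eq_self h' 3
    refine card_invariant_functions _ 4 _ h4 ?_
    simp only [Finset.sum_range_succ, Finset.sum_range_zero, pow_zero, pow_one, h3, hsq, hfix,
      orbitsAB]
    simp only [Equiv.Perm.one_apply, Finset.filter_true, Finset.card_univ, ZMod.card, add_eq_left,
      h20, Finset.filter_false, Finset.card_empty]
    split_ifs <;> omega

/-! ### Sums over the group -/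

theorem bijective_normal_form (n : ℕ) (hn : 2 ≤ n) : Function.Bijective
    (Sum.elim (fun i : Fin (4 * n) => gA n ^ (i : ℕ))
      fun i : Fin (4 * n) => gA n ^ (i : ℕ) * gB n) := by
  have : NeZero (4 * n) := ⟨by omega⟩
  have hcast : ∀ i j : Fin (4 * n), ((i : ℕ) : ZMod (4 * n)) = (j : ℕ) → i = j := by
    intro i j h
    rw [ZMod.natCast_eq_natCast_iff] at h
    exact Fin.ext (Nat.ModEq.eq_of_lt_of_lt h i.2 j.2)
  have h2 : (2 * (n : ZMod (4 * n)) - 1) ≠ 1 := by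
    intro h1
    have h2 : ((2 * n - 2 : ℕ) : ZMod (4 * n)) = 0 := by
      rw [Nat.cast_sub (by omega)]
      push_cast
      linear_combination h1
    have h3 := Nat.le_of_dvd (by omega) ((ZMod.natCast_eq_zero_iff _ _).mp h2)
    omega
  constructor
  · rintro (i | i) (j | j) h <;> simp only [Sum.elim_inl, Sum.elim_inr] at h
    all_goals
      -- The image of 0 determines the exponent of `a`; the image of 1 then detects `b`, because `2n
      -- - 1 ≠ 1` modulo `4n`.
      have h0 := congrArg (fun g => embed n g 0) h
      have h1 := congrArg (fun g => embed n g 1) h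
      simp only [embed_a_pow, embed_a_pow_b, mul_zero, zero_add, mul_one] at h0 h1
    · rw [hcast _ _ h0]
    · rw [h0] at h1; exact absurd (add_right_cancel h1).symm h2
    · rw [h0] at h1; exact absurd (add_right_cancel h1) h2
    · rw [hcast _ _ h0]
  · intro g
    have key : ∀ i : ℤ, ∃ j : Fin (4 * n), gA n ^ i = gA n ^ (j : ℕ) := by
      intro i
      refine ⟨⟨(i % (4 * n : ℕ)).toNat, ?_⟩, ?_⟩
      · have := Int.emod_lt_of_pos i (b := (4 * n : ℕ)) (by omega)
        omega
      · rw [← zpow_natCast, Int.toNat_of_nonneg (Int.emod_nonneg _ (by omega))]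
        conv_lhs => rw [← Int.emod_add_mul_ediv i (4 * n : ℕ)]
        rw [zpow_add, zpow_mul, zpow_natCast, gA_pow, one_zpow, mul_one]
    obtain ⟨i, rfl | rfl⟩ := exists_normal_form n g
    · obtain ⟨j, hj⟩ := key i
      exact ⟨Sum.inl j, hj.symm⟩
    · obtain ⟨j, hj⟩ := key i
      exact ⟨Sum.inr j, by simp [hj]⟩

theorem sum_SD (n : ℕ) (hn : 2 ≤ n) [Fintype (SD n)] {M : Type*} [AddCommMonoid M] (F : SD n → M) :
    ∑ g, F g = ∑ i ∈ Finset.range (4 * n), F (gA n ^ i) +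
      ∑ i ∈ Finset.range (4 * n), F (gA n ^ i * gB n) := by
  rw [← (bijective_normal_form n hn).sum_comp, Fintype.sum_sum_type, Finset.sum_range,
    Finset.sum_range]
  rfl

theorem card_SD (n : ℕ) (hn : 2 ≤ n) : Nat.card (SD n) = 8 * n := by
  rw [← Nat.card_congr (Equiv.ofBijective _ (bijective_normal_form n hn))]
  simp
  ring

/-- The dimension of a symmetry class as a weighted sum of orbit counts. -/
theorem dimClass_eq (n : ℕ) (hn2 : 2 ≤ n) (hn : Odd n) (V : Type*) [AddCommGroup V] [Module ℂ V]
    [FiniteDimensional ℂ V] [Fintype (SD n)] (χ : SD n → ℂ)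
    (h : ∀ g, χ 1 * ∑ x, χ x * χ (x⁻¹ * g) = (8 * n : ℂ) * χ g) :
    (dimClass n V χ : ℂ) = χ 1 / (8 * n) *
      (∑ k ∈ Finset.range (4 * n),
          χ (gA n ^ k) * (Module.finrank ℂ V : ℂ) ^ Nat.gcd (4 * n) k +
        ∑ k ∈ Finset.range (4 * n),
          χ (gA n ^ k * gB n) * (Module.finrank ℂ V : ℂ) ^ orbitsAB n k) := by
  have : NeZero n := ⟨by omega⟩
  have hc : (Nat.card (SD n) : ℂ) = 8 * n := by rw [card_SD n hn2]; push_cast; rfl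
  rw [dimClass, finrank_symmetryClass (embed n) χ V (by rw [hc]; exact h), hc, sum_SD n hn2]
  simp only [trace_permOp, card_invariant_a, card_invariant_ab n _ hn, Nat.card_fin, Nat.cast_pow]

/-! ### Linear characters -/

theorem linChar_mul (n : ℕ) (hn : Odd n) (α β : ℂˣ) (hα : α ^ 4 = 1) (hβ : β ^ 2 = 1)
    (g g' : SD n) :
    linChar n hn α β hα hβ (g * g') = linChar n hn α β hα hβ g * linChar n hn α β hα hβ g' := by
  simp [linChar]

theorem linChar_one (n : ℕ) (hn : Odd n) (α β : ℂˣ) (hα : α ^ 4 = 1) (hβ : β ^ 2 = 1) :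
    linChar n hn α β hα hβ 1 = 1 := by
  simp [linChar]

theorem linChar_a_pow (n : ℕ) (hn : Odd n) (α β : ℂˣ) (hα : α ^ 4 = 1) (hβ : β ^ 2 = 1) (k : ℕ) :
    linChar n hn α β hα hβ (gA n ^ k) = (α : ℂ) ^ k := by
  simp [linChar, lift_a]

theorem linChar_a_pow_b (n : ℕ) (hn : Odd n) (α β : ℂˣ) (hα : α ^ 4 = 1) (hβ : β ^ 2 = 1)
    (k : ℕ) : linChar n hn α β hα hβ (gA n ^ k * gB n) = (α : ℂ) ^ k * β := by
  simp [linChar, lift_a, lift_b]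

theorem sum_range_of_period_four {M : Type*} [AddCommMonoid M] (f : ℕ → M)
    (hf : ∀ k, f (k + 4) = f k) (n : ℕ) :
    ∑ k ∈ Finset.range (4 * n), f k = n • (f 0 + f 1 + f 2 + f 3) := by
  have hf' : ∀ n j, f (4 * n + j) = f j := by
    intro n j
    induction n with
    | zero => simp
    | succ n ih => rw [← ih, ← hf (4 * n + j)]; congr 1; ring
  induction n with
  | zero => simp
  | succ n ih =>
    rw [mul_add, mul_one, Finset.sum_range_add, ih, succ_nsmul]
    simp [Finset.sum_range_succ, hf']

/-- Both `α ^ k` and `orbitsAB n k` depend only on `k` modulo 4, so the coset of `b` contributes `n`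
copies of one period. -/
theorem dimClass_linChar (n : ℕ) (hn2 : 2 ≤ n) (hn : Odd n) (V : Type*) [AddCommGroup V]
    [Module ℂ V] [FiniteDimensional ℂ V] (m : ℕ) (hm : Module.finrank ℂ V = m)
    (α β : ℂˣ) (hα : α ^ 4 = 1) (hβ : β ^ 2 = 1) :
    (dimClass n V (linChar n hn α β hα hβ) : ℂ) = 1 / (8 * n) *
      (∑ k ∈ Finset.range (4 * n), (α : ℂ) ^ k * (m : ℂ) ^ Nat.gcd (4 * n) k +
        n * β * (m ^ (2 * n + 2) + (α : ℂ) ^ 2 * m ^ (2 * n) + (α + (α : ℂ) ^ 3) * m ^ n)) := by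
  have := finite_SD n hn2
  have := Fintype.ofFinite (SD n)
  have hα' : (α : ℂ) ^ 4 = 1 := by rw [← Units.val_pow_eq_pow_val, hα, Units.val_one]
  rw [dimClass_eq n hn2 hn, linChar_one, hm]
  · simp only [linChar_a_pow, linChar_a_pow_b]
    rw [sum_range_of_period_four
      (fun k => (α : ℂ) ^ k * β * (m : ℂ) ^ orbitsAB n k)]
    · simp only [orbitsAB, nsmul_eq_mul]
      norm_num
      left
      ring
    · intro k
      simp only [orbitsAB, pow_add _ k 4, hα']
      have h4 : (k + 4) % 4 = k % 4 := by omega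
      have h2 : (k + 4) % 2 = k % 2 := by omega
      rw [h4, h2, mul_one]
  · intro g
    simp only [← linChar_mul, mul_inv_cancel_left, linChar_one, Finset.sum_const, Finset.card_univ,
      ← Nat.card_eq_fintype_card, card_SD n hn2]
    simp

/-! ### Two-dimensional characters -/

theorem isPrimitiveRoot_omega (n : ℕ) (hn : n ≠ 0) : IsPrimitiveRoot (omega n) (4 * n) := by
  have h := Complex.isPrimitiveRoot_exp (4 * n) (by omega)
  convert h using 1
  rw [omega]
  congr 1
  have : (n : ℂ) ≠ 0 := by exact_mod_cast hn
  push_cast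
  field_simp
  ring

theorem sum_pow_eq_zero {z : ℂ} {N : ℕ} (hz : z ^ N = 1) (h1 : z ≠ 1) :
    ∑ k ∈ Finset.range N, z ^ k = 0 := by
  rw [geom_sum_eq h1, hz, sub_self, zero_div]

/-- The diagonal products do not depend on `r`; the mixed ones are geometric sums in `α / β` and `β
/ α`, nontrivial `N`-th roots of unity, and vanish. -/
theorem sum_zpow_mul_zpow {α β : ℂ} {N : ℕ} (hα : α ^ N = 1) (hβ : β ^ N = 1) (h : α ≠ β)
    (hα0 : α ≠ 0) (hβ0 : β ≠ 0) (k : ℤ) :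
    ∑ r ∈ Finset.range N, (α ^ (r : ℤ) + β ^ (r : ℤ)) * (α ^ (k - r) + β ^ (k - r)) =
      N * (α ^ k + β ^ k) := by
  have h1 : ∑ r ∈ Finset.range N, (α / β) ^ r = 0 :=
    sum_pow_eq_zero (by rw [div_pow, hα, hβ, div_one]) (fun h' => h ((div_eq_one_iff_eq hβ0).mp h'))
  have h2 : ∑ r ∈ Finset.range N, (β / α) ^ r = 0 :=
    sum_pow_eq_zero (by rw [div_pow, hα, hβ, div_one])
      (fun h' => h ((div_eq_one_iff_eq hα0).mp h').symm)
  calc _ = ∑ r ∈ Finset.range N, ((α ^ k + β ^ k) + β ^ k * (α / β) ^ r + α ^ k * (β / α) ^ r) := by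
        refine Finset.sum_congr rfl fun r _ => ?_
        rw [zpow_sub₀ hα0, zpow_sub₀ hβ0, zpow_natCast, zpow_natCast]
        rw [div_pow, div_pow]
        field_simp
        ring
    _ = _ := by
        rw [Finset.sum_add_distrib, Finset.sum_add_distrib, ← Finset.mul_sum, ← Finset.mul_sum,
          h1, h2]
        simp [mul_add]

theorem rhoChar_one (n h : ℕ) : rhoChar n h 1 = 2 := by
  have := rhoChar_a_zpow n h 0
  norm_num at this
  exact this

/-- For `h` not divisible by `n` the character of `ρ^h` satisfies the convolution identity of an
irreducible character. -/
theorem rhoChar_convolution (n h : ℕ) (hn2 : 2 ≤ n) (hh : ¬ n ∣ h) [Fintype (SD n)]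
    (g : SD n) : rhoChar n h 1 * ∑ x, rhoChar n h x * rhoChar n h (x⁻¹ * g) =
      (8 * n : ℂ) * rhoChar n h g := by
  have hne : omega n ^ (h : ℤ) ≠ omega n ^ ((2 * (n : ℤ) - 1) * h) := by
    intro heq
    have h1 : omega n ^ ((2 * (n : ℤ) - 1) * h - h) = 1 := by
      rw [zpow_sub₀ (omega_ne_zero n), ← heq, div_self (zpow_ne_zero _ (omega_ne_zero n))]
    rw [(isPrimitiveRoot_omega n (by omega)).zpow_eq_one_iff_dvd] at h1
    obtain ⟨c, hc⟩ := h1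
    apply hh
    push_cast at hc
    have : ((n : ℤ)) ∣ h := by
      -- Equal eigenvalues would give `(2n-2)h = 4nc`, that is, `h = n(h - 2c)`.
      have h2 : (h : ℤ) = n * (h - 2 * c) := by linarith
      exact Dvd.intro _ h2.symm
    exact_mod_cast this
  have hpow : ∀ j : ℤ, (omega n ^ j) ^ (4 * n) = 1 := by
    intro j
    rw [← zpow_natCast, ← zpow_mul, mul_comm]
    exact_mod_cast omega_zpow n j
  have hw := omega_ne_zero n
  rw [sum_SD n hn2, rhoChar_one]
  simp only [← zpow_natCast, rhoChar_a_zpow_b, zero_mul, Finset.sum_const_zero, add_zero]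
  obtain ⟨i, rfl | rfl⟩ := exists_normal_form n g
  · simp only [← zpow_neg, ← zpow_add, rhoChar_a_zpow]
    have := sum_zpow_mul_zpow (hpow h) (hpow ((2 * (n : ℤ) - 1) * h)) hne (zpow_ne_zero _ hw)
      (zpow_ne_zero _ hw) i
    simp only [← zpow_mul] at this
    simp only [neg_add_eq_sub]
    rw [this]
    push_cast
    ring
  · simp only [← mul_assoc, ← zpow_neg, ← zpow_add, rhoChar_a_zpow_b, mul_zero,
      Finset.sum_const_zero]

/-- As `ω^(2n) = -1`, the second eigenvalue is the inverse of the first up to the sign `(-1)^(hk)`.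
For even `hk` the value is therefore twice a cosine. -/
theorem rhoChar_a_pow (n h k : ℕ) (hn : n ≠ 0) : rhoChar n h (gA n ^ k) =
    omega n ^ (h * k) + (-1) ^ (h * k) * (omega n ^ (h * k))⁻¹ := by
  have h2n : omega n ^ (2 * n) = -1 := by
    have : (n : ℂ) ≠ 0 := by exact_mod_cast hn
    rw [omega, ← Complex.exp_nat_mul, ← Complex.exp_pi_mul_I]
    congr 1
    push_cast
    field_simp
  rw [← zpow_natCast, rhoChar_a_zpow, ← h2n, ← pow_mul, ← zpow_natCast, ← zpow_natCast, ← zpow_neg,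
    ← zpow_add₀ (omega_ne_zero n)]
  push_cast
  congr 2
  ring

theorem omega_pow_add_inv (n j : ℕ) (hn : n ≠ 0) :
    omega n ^ j + (omega n ^ j)⁻¹ = 2 * (Real.cos (j * Real.pi / (2 * n)) : ℂ) := by
  have : (n : ℂ) ≠ 0 := by exact_mod_cast hn
  rw [omega, ← Complex.exp_nat_mul, ← Complex.exp_neg, Complex.ofReal_cos, Complex.two_cos]
  push_cast
  congr 2 <;> ring

theorem dimClass_rhoChar (n h : ℕ) (hn2 : 2 ≤ n) (hn : Odd n) (hh : ¬ n ∣ h) (V : Type*)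
    [AddCommGroup V] [Module ℂ V] [FiniteDimensional ℂ V] (m : ℕ)
    (hm : Module.finrank ℂ V = m) :
    (dimClass n V (rhoChar n h) : ℂ) = 1 / (4 * n) *
      ∑ k ∈ Finset.range (4 * n), rhoChar n h (gA n ^ k) * (m : ℂ) ^ Nat.gcd (4 * n) k := by
  have := finite_SD n hn2
  have := Fintype.ofFinite (SD n)
  rw [dimClass_eq n hn2 hn V _ (rhoChar_convolution n h hn2 hh), rhoChar_one, hm]
  have h0 : ∀ k, rhoChar n h (gA n ^ k * gB n) = 0 := fun k => by
    rw [← zpow_natCast, rhoChar_a_zpow_b]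
  simp only [h0, zero_mul, Finset.sum_const_zero, add_zero]
  ring

/-! ### Index sets and sums split by parity -/

theorem mem_CdagEven {n k : ℕ} : k ∈ CdagEven n ↔ Even k ∧ 0 < k ∧ k < 2 * n := by
  simp only [CdagEven, C1, Finset.mem_sdiff, Finset.mem_filter, Finset.mem_Icc, Finset.mem_insert,
    Finset.mem_singleton, Nat.even_iff]
  omega

theorem mem_CdagOdd {n k : ℕ} :
    k ∈ CdagOdd n ↔ Odd k ∧ (k < n ∨ 2 * n < k ∧ k < 3 * n) := by
  simp only [CdagOdd, Finset.mem_filter, Finset.mem_union, Finset.mem_Icc, Nat.odd_iff]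
  omega

/-- On even residues, multiplication by `2n - 1` is negation, because `2n s` is a multiple of `4n`.
-/
theorem bar_CdagEven (n : ℕ) : bar n (CdagEven n) = (CdagEven n).image (4 * n - ·) := by
  refine Finset.image_congr fun s hs => ?_
  obtain ⟨⟨u, rfl⟩, h0, h1⟩ := mem_CdagEven.mp hs
  -- These substitutions remove the truncated subtractions.
  obtain ⟨u, rfl⟩ : ∃ v, u = v + 1 := ⟨u - 1, by omega⟩
  obtain ⟨p, rfl⟩ : ∃ p, n = u + 2 + p := ⟨n - (u + 2), by omega⟩
  have h2 : (u + 1 + (u + 1)) * (2 * (u + 2 + p) - 1) =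
      4 * (u + 2 + p) - (u + 1 + (u + 1)) + 4 * (u + 2 + p) * u := by
    rw [show 2 * (u + 2 + p) - 1 = 2 * u + 3 + 2 * p by omega,
      show 4 * (u + 2 + p) - (u + 1 + (u + 1)) = 2 * u + 6 + 4 * p by omega]
    ring
  change _ % _ = _
  rw [h2, Nat.add_mul_mod_self_left, Nat.mod_eq_of_lt]
  omega

/-- For odd `s` one has `2n s ≡ 2n`, so `s` goes to `2n - s`; for `s > 2n` a further `4n` brings it
into range. -/
theorem bar_CdagOdd (n : ℕ) : bar n (CdagOdd n) =
    (CdagOdd n).image (fun s => if s < n then 2 * n - s else 6 * n - s) := by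
  refine Finset.image_congr fun s hs => ?_
  obtain ⟨⟨u, rfl⟩, h⟩ := mem_CdagOdd.mp hs
  change _ % _ = if _ then _ else _
  zify [show 1 ≤ 2 * n by omega]
  split_ifs with h'
  · have h' : 2 * u + 1 < n := by omega
    have h2 : (((2 * n - (2 * u + 1) : ℕ) : ℤ)) = 2 * n - (2 * u + 1) := by omega
    rw [h2, show (2 * (u : ℤ) + 1) * (2 * n - 1) = (2 * n - (2 * u + 1)) + 4 * n * u by ring,
      Int.add_mul_emod_self_left, Int.emod_eq_of_lt (by omega) (by omega)]
  · have h2 : (((6 * n - (2 * u + 1) : ℕ) : ℤ)) = 6 * n - (2 * u + 1) := by omega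
    rw [h2, show (2 * (u : ℤ) + 1) * (2 * n - 1) = (6 * n - (2 * u + 1)) + 4 * n * (u - 1) by ring,
      Int.add_mul_emod_self_left, Int.emod_eq_of_lt (by omega) (by omega)]

theorem CdagEven_union_bar (n : ℕ) : CdagEven n ∪ bar n (CdagEven n) =
    {k ∈ Finset.range (4 * n) | Even k ∧ k ≠ 0 ∧ k ≠ 2 * n} := by
  ext k
  simp only [bar_CdagEven, Finset.mem_union, Finset.mem_image, mem_CdagEven, Finset.mem_filter,
    Finset.mem_range, Nat.even_iff]
  constructor
  · rintro (h | ⟨s, h, rfl⟩) <;> omega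
  · intro h
    by_cases h' : k < 2 * n
    · left; omega
    · right; exact ⟨4 * n - k, by omega, by omega⟩

/-- The missing residues `n` and `3n` are the fixed points of `s ↦ 2n - s` modulo `4n`. -/
theorem CdagOdd_union_bar (n : ℕ) (hn : Odd n) : CdagOdd n ∪ bar n (CdagOdd n) =
    {k ∈ Finset.range (4 * n) | Odd k ∧ k ≠ n ∧ k ≠ 3 * n} := by
  ext k
  simp only [bar_CdagOdd, Finset.mem_union, Finset.mem_image, mem_CdagOdd, Finset.mem_filter,
    Finset.mem_range, Nat.odd_iff] at hn ⊢
  constructor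
  · rintro (h | ⟨s, h, rfl⟩)
    · omega
    · split_ifs <;> omega
  · intro h
    by_cases h1 : k < n ∨ 2 * n < k ∧ k < 3 * n
    · left; omega
    · right
      by_cases h2 : k < 2 * n
      · exact ⟨2 * n - k, by omega, by rw [if_pos (by omega)]; omega⟩
      · exact ⟨6 * n - k, by omega, by rw [if_neg (by omega)]; omega⟩

theorem sum_filter_even {M : Type*} [AddCommMonoid M] (n : ℕ) (hn : n ≠ 0) (f : ℕ → M) :
    ∑ k ∈ Finset.range (4 * n) with Even k, f k =
      f 0 + (f (2 * n) + ∑ k ∈ CdagEven n ∪ bar n (CdagEven n), f k) := by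
  rw [CdagEven_union_bar, ← Finset.sum_insert, ← Finset.sum_insert]
  · congr 1
    ext k
    simp only [Finset.mem_filter, Finset.mem_range, Finset.mem_insert, Nat.even_iff]
    omega
  · simp only [Finset.mem_filter, Finset.mem_range, Finset.mem_insert, Nat.even_iff]
    omega
  · simp

theorem sum_filter_odd {M : Type*} [AddCommMonoid M] (n : ℕ) (hn : Odd n) (f : ℕ → M) :
    ∑ k ∈ Finset.range (4 * n) with ¬ Even k, f k =
      f n + (f (3 * n) + ∑ k ∈ CdagOdd n ∪ bar n (CdagOdd n), f k) := by
  have h := Nat.odd_iff.mp hn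
  rw [CdagOdd_union_bar n hn, ← Finset.sum_insert, ← Finset.sum_insert]
  · congr 1
    ext k
    simp only [Finset.mem_filter, Finset.mem_range, Finset.mem_insert, Nat.even_iff, Nat.odd_iff]
    omega
  · simp only [Finset.mem_filter, Finset.mem_range, Finset.mem_insert, Nat.odd_iff]
    omega
  · simp

theorem sum_CdagEven_union_bar {R : Type*} [NonAssocSemiring R] (n : ℕ) (f : ℕ → R)
    (hf : ∀ k ∈ CdagEven n, f (4 * n - k) = f k) :
    ∑ k ∈ CdagEven n ∪ bar n (CdagEven n), f k = 2 * ∑ k ∈ CdagEven n, f k := by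
  rw [Finset.sum_union, bar_CdagEven, Finset.sum_image, Finset.sum_congr rfl hf, two_mul]
  · intro x hx y hy hxy
    have := mem_CdagEven.mp hx
    have := mem_CdagEven.mp hy
    simp only at hxy
    omega
  · rw [bar_CdagEven, Finset.disjoint_right]
    intro k hk
    obtain ⟨s, hs, rfl⟩ := Finset.mem_image.mp hk
    rw [mem_CdagEven] at hs ⊢
    omega

/-- The reflection `k ↦ 4n - k` permutes the odd indices, so the sum equals its own negative. It
applies to `α = ±i` and to `ρ^h` with odd `h`. -/
theorem sum_filter_odd_eq_zero (n : ℕ) (f : ℕ → ℂ)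
    (hf : ∀ k, Odd k → k < 4 * n → f (4 * n - k) = -f k) :
    ∑ k ∈ Finset.range (4 * n) with ¬ Even k, f k = 0 := by
  have h : ∑ k ∈ Finset.range (4 * n) with ¬ Even k, f k =
      ∑ k ∈ Finset.range (4 * n) with ¬ Even k, -f k := by
    refine Finset.sum_nbij' (4 * n - ·) (4 * n - ·) ?_ ?_ ?_ ?_ ?_ <;>
      simp only [Finset.mem_filter, Finset.mem_range, Nat.even_iff]
    · omega
    · omega
    · omega
    · omega
    · intro k hk
      rw [hf k (Nat.odd_iff.mpr (by omega)) hk.1, neg_neg]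
  rw [Finset.sum_neg_distrib] at h
  exact self_eq_neg.mp h

theorem gcd_four_mul_sub (n k : ℕ) (hk : k ≤ 4 * n) :
    Nat.gcd (4 * n) (4 * n - k) = Nat.gcd (4 * n) k := Nat.gcd_self_sub_right hk

theorem gcd_four_mul_two_mul (n : ℕ) : Nat.gcd (4 * n) (2 * n) = 2 * n := by
  rw [Nat.gcd_mul_right]; norm_num

theorem gcd_four_mul_self (n : ℕ) : Nat.gcd (4 * n) n = n := by simp

theorem gcd_four_mul_three_mul (n : ℕ) : Nat.gcd (4 * n) (3 * n) = n := by
  rw [Nat.gcd_mul_right]; simp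

/-! ### Dimension formulas for each family of characters -/

theorem dimClass_linChar_one (n : ℕ) (hn2 : 2 ≤ n) (hn : Odd n) (V : Type*)
    [AddCommGroup V] [Module ℂ V] [FiniteDimensional ℂ V] (m : ℕ)
    (hm : Module.finrank ℂ V = m)
    (β : ℂˣ) (hβ : β ^ 2 = 1) :
    (dimClass n V (linChar n hn 1 β (one_pow 4) hβ) : ℂ) = 1 / (8 * n) *
      (β * (2 * n * m ^ n + n * m ^ (2 * n) + n * m ^ (2 * n + 2)) +
        ∑ k ∈ Finset.range (4 * n), (m : ℂ) ^ Nat.gcd (4 * n) k) := by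
  rw [dimClass_linChar n hn2 hn V m hm]
  simp only [Units.val_one, one_pow, one_mul]
  ring

/-- Odd powers of `a` enter with a minus sign; the indices `n` and `3n` both have gcd `n`, whence
`-2 m^n`. -/
theorem dimClass_linChar_neg_one (n : ℕ) (hn2 : 2 ≤ n) (hn : Odd n) (V : Type*)
    [AddCommGroup V] [Module ℂ V] [FiniteDimensional ℂ V] (m : ℕ)
    (hm : Module.finrank ℂ V = m)
    (β : ℂˣ) (hβ : β ^ 2 = 1) :
    (dimClass n V (linChar n hn (-1) β neg_one_pow_four hβ) : ℂ) = 1 / (8 * n) *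
      (m ^ (4 * n) + m ^ (2 * n) - 2 * m ^ n
        + 2 * ∑ k ∈ CdagEven n, (m : ℂ) ^ Nat.gcd (4 * n) k
        - ∑ k ∈ CdagOdd n ∪ bar n (CdagOdd n), (m : ℂ) ^ Nat.gcd (4 * n) k
        + β * (-(2 * n * m ^ n) + n * m ^ (2 * n) + n * m ^ (2 * n + 2))) := by
  rw [dimClass_linChar n hn2 hn V m hm, ← Finset.sum_filter_add_sum_filter_not _ (Even ·)]
  have he : ∑ k ∈ Finset.range (4 * n) with Even k,
      (((-1 : ℂˣ) : ℂ)) ^ k * (m : ℂ) ^ Nat.gcd (4 * n) k =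
      ∑ k ∈ Finset.range (4 * n) with Even k, (m : ℂ) ^ Nat.gcd (4 * n) k :=
    Finset.sum_congr rfl fun k hk => by
      rw [Units.val_neg, Units.val_one, (Finset.mem_filter.mp hk).2.neg_one_pow, one_mul]
  have ho : ∑ k ∈ Finset.range (4 * n) with ¬ Even k,
      (((-1 : ℂˣ) : ℂ)) ^ k * (m : ℂ) ^ Nat.gcd (4 * n) k =
      -∑ k ∈ Finset.range (4 * n) with ¬ Even k, (m : ℂ) ^ Nat.gcd (4 * n) k := by
    rw [← Finset.sum_neg_distrib]
    refine Finset.sum_congr rfl fun k hk => ?_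
    rw [Units.val_neg, Units.val_one,
      (Nat.not_even_iff_odd.mp (Finset.mem_filter.mp hk).2).neg_one_pow, neg_one_mul]
  rw [he, ho, sum_filter_even n (by omega), sum_filter_odd n hn, sum_CdagEven_union_bar,
    gcd_four_mul_two_mul, gcd_four_mul_self, gcd_four_mul_three_mul, Nat.gcd_zero_right]
  · simp only [Units.val_neg, Units.val_one]
    ring
  · intro k hk
    rw [gcd_four_mul_sub _ _ (by have := mem_CdagEven.mp hk; omega)]

/-- Here `α + α^3 = 0` removes the odd exponents in the coset of `b`, and `α^(2n) = (-1)^n = -1`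
gives `-m^(2n)`. Only `α^2` survives, so `i` and `-i` give the same dimension. -/
theorem dimClass_linChar_of_sq_eq_neg_one (n : ℕ) (hn2 : 2 ≤ n) (hn : Odd n) (V : Type*)
    [AddCommGroup V] [Module ℂ V] [FiniteDimensional ℂ V] (m : ℕ)
    (hm : Module.finrank ℂ V = m)
    (α β : ℂˣ) (hα : α ^ 4 = 1) (hα2 : (α : ℂ) ^ 2 = -1)
    (hβ : β ^ 2 = 1) :
    (dimClass n V (linChar n hn α β hα hβ) : ℂ) = 1 / (8 * n) *
      (m ^ (4 * n) - m ^ (2 * n)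
        + ∑ k ∈ CdagEven n ∪ bar n (CdagEven n), (-1 : ℂ) ^ (k / 2) * (m : ℂ) ^ Nat.gcd (4 * n) k
        + β * (n * m ^ (2 * n + 2) - n * m ^ (2 * n))) := by
  rw [dimClass_linChar n hn2 hn V m hm, ← Finset.sum_filter_add_sum_filter_not _ (Even ·),
    sum_filter_odd_eq_zero, sum_filter_even n (by omega), gcd_four_mul_two_mul, Nat.gcd_zero_right,
    pow_mul _ 2 n, hα2, hn.neg_one_pow, pow_succ (α : ℂ) 2, hα2]
  · have : ∑ k ∈ CdagEven n ∪ bar n (CdagEven n), (α : ℂ) ^ k * (m : ℂ) ^ Nat.gcd (4 * n) k =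
        ∑ k ∈ CdagEven n ∪ bar n (CdagEven n), (-1 : ℂ) ^ (k / 2) * (m : ℂ) ^ Nat.gcd (4 * n) k := by
      refine Finset.sum_congr rfl fun k hk => ?_
      rw [CdagEven_union_bar] at hk
      conv_lhs => rw [← Nat.two_mul_div_two_of_even (Finset.mem_filter.mp hk).2.1]
      rw [pow_mul, hα2, Nat.two_mul_div_two_of_even (Finset.mem_filter.mp hk).2.1]
    rw [this]
    ring
  · intro k hk hk4
    rw [gcd_four_mul_sub _ _ hk4.le, ← neg_mul]
    congr 1
    have h4 : (α : ℂ) ^ (4 * n) = 1 := by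
      rw [show 4 * n = 2 * (2 * n) by ring, pow_mul, hα2, (even_two_mul n).neg_one_pow]
    have h2 : (α : ℂ) ^ k * α ^ k = -1 := by
      rw [← mul_pow, ← sq, hα2, hk.neg_one_pow]
    have h3 : (α : ℂ) ^ (4 * n - k) * α ^ k = 1 := by rw [← pow_add, Nat.sub_add_cancel hk4.le, h4]
    have h5 : (α : ℂ) ^ k ≠ 0 := pow_ne_zero _ α.ne_zero
    exact mul_right_cancel₀ h5 (by rw [h3, neg_mul, h2, neg_neg])

theorem dimClass_rhoChar_even (n : ℕ) (hn2 : 2 ≤ n) (hn : Odd n) (V : Type*)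
    [AddCommGroup V] [Module ℂ V] [FiniteDimensional ℂ V] (m : ℕ)
    (hm : Module.finrank ℂ V = m)
    (h : ℕ) (hh : ¬ n ∣ h) (he : Even h) :
    (dimClass n V (rhoChar n h) : ℂ) = 1 / (2 * n) *
      ∑ k ∈ Finset.range (4 * n),
        (m : ℂ) ^ Nat.gcd (4 * n) k * (Real.cos (h * k * Real.pi / (2 * n)) : ℂ) := by
  have : (n : ℂ) ≠ 0 := by exact_mod_cast (show n ≠ 0 by omega)
  rw [dimClass_rhoChar n h hn2 hn hh V m hm]
  have key : ∀ k : ℕ, rhoChar n h (gA n ^ k) = 2 * (Real.cos (h * k * Real.pi / (2 * n)) : ℂ) := by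
    intro k
    rw [rhoChar_a_pow n h k (by omega), (he.mul_right k).neg_one_pow, one_mul,
      omega_pow_add_inv n _ (by omega)]
    push_cast
    rfl
  simp only [key, mul_assoc]
  rw [← Finset.mul_sum]
  simp only [mul_comm ((m : ℂ) ^ _)]
  rw [← mul_assoc, show 1 / (4 * n : ℂ) * 2 = 1 / (2 * n) by field_simp; norm_num]

/-- Odd `k` cancel under `k ↦ 4n - k`. The indices 0 and `2n` carry the values 2 and -2; the other
even ones pair up, and with the factor 2 of the cosine this yields the coefficient 4. -/
theorem dimClass_rhoChar_odd (n : ℕ) (hn2 : 2 ≤ n) (hn : Odd n) (V : Type*)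
    [AddCommGroup V] [Module ℂ V] [FiniteDimensional ℂ V] (m : ℕ)
    (hm : Module.finrank ℂ V = m)
    (h : ℕ) (hh : ¬ n ∣ h) (ho : Odd h) :
    (dimClass n V (rhoChar n h) : ℂ) = 1 / (4 * n) *
      (2 * m ^ (4 * n) - 2 * m ^ (2 * n) + 4 * ∑ k ∈ CdagEven n,
        (m : ℂ) ^ Nat.gcd (4 * n) k * (Real.cos (h * k * Real.pi / (2 * n)) : ℂ)) := by
  have hn0 : n ≠ 0 := by omega
  have hnC : (n : ℂ) ≠ 0 := by exact_mod_cast hn0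
  have hw : ∀ j, omega n ^ j ≠ 0 := fun j => pow_ne_zero _ (omega_ne_zero n)
  have hinv : ∀ k, k ≤ 4 * n → omega n ^ (h * (4 * n - k)) = (omega n ^ (h * k))⁻¹ := by
    intro k hk
    refine eq_inv_of_mul_eq_one_left ?_
    rw [← pow_add, ← mul_add, Nat.sub_add_cancel hk, mul_comm, pow_mul, omega_pow, one_pow]
  have key : ∀ k : ℕ, Even k →
      rhoChar n h (gA n ^ k) = 2 * (Real.cos (h * k * Real.pi / (2 * n)) : ℂ) := by
    intro k hk
    rw [rhoChar_a_pow n h k (by omega), (hk.mul_left h).neg_one_pow, one_mul,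
      omega_pow_add_inv n _ (by omega)]
    push_cast
    rfl
  have heven : ∀ k, Even k → k ≤ 4 * n →
      rhoChar n h (gA n ^ (4 * n - k)) = rhoChar n h (gA n ^ k) := by
    intro k hk hk4
    have hk' : Even (4 * n - k) := by rw [Nat.even_iff] at hk ⊢; omega
    rw [rhoChar_a_pow n h _ hn0, rhoChar_a_pow n h _ hn0, (hk.mul_left h).neg_one_pow,
      (hk'.mul_left h).neg_one_pow, hinv k hk4, inv_inv]
    ring
  have hodd : ∀ k, Odd k → k < 4 * n →
      rhoChar n h (gA n ^ (4 * n - k)) = -rhoChar n h (gA n ^ k) := by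
    intro k hk hk4
    have hk' : Odd (4 * n - k) := by rw [Nat.odd_iff] at hk ⊢; omega
    rw [rhoChar_a_pow n h _ hn0, rhoChar_a_pow n h _ hn0, (ho.mul hk).neg_one_pow,
      (ho.mul hk').neg_one_pow, hinv k hk4.le, inv_inv]
    ring
  have h0 : rhoChar n h (gA n ^ 0) = 2 := by rw [pow_zero, rhoChar_one]
  have h2 : rhoChar n h (gA n ^ (2 * n)) = -2 := by
    rw [key _ (even_two_mul n), show (h : ℝ) * (2 * n : ℕ) * Real.pi / (2 * n) = h * Real.pi by
      have : (n : ℝ) ≠ 0 := by exact_mod_cast hn0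
      push_cast; field_simp, Real.cos_nat_mul_pi, ho.neg_one_pow]
    norm_num
  rw [dimClass_rhoChar n h hn2 hn hh V m hm, ← Finset.sum_filter_add_sum_filter_not _ (Even ·),
    sum_filter_odd_eq_zero, sum_filter_even n hn0, gcd_four_mul_two_mul, Nat.gcd_zero_right,
    sum_CdagEven_union_bar, h0, h2]
  · have : ∑ k ∈ CdagEven n, rhoChar n h (gA n ^ k) * (m : ℂ) ^ Nat.gcd (4 * n) k =
        2 * ∑ k ∈ CdagEven n,
          (m : ℂ) ^ Nat.gcd (4 * n) k * (Real.cos (h * k * Real.pi / (2 * n)) : ℂ) := by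
      rw [Finset.mul_sum]
      refine Finset.sum_congr rfl fun k hk => ?_
      rw [key k (mem_CdagEven.mp hk).1]
      ring
    rw [this]
    ring
  · intro k hk
    obtain ⟨hk1, _, hk3⟩ := mem_CdagEven.mp hk
    rw [heven k hk1 (by omega), gcd_four_mul_sub _ _ (by omega)]
  · intro k hk hk4
    rw [hodd k hk hk4, gcd_four_mul_sub _ _ hk4.le, neg_mul]

end SemiDihedral

open SemiDihedral in
theorem theorem2p10 (n : ℕ) (hn2 : 2 ≤ n) (hn : Odd n)
    (V : Type*) [NormedAddCommGroup V] [InnerProductSpace ℂ V] [FiniteDimensional ℂ V]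
    (m : ℕ) (hm : Module.finrank ℂ V = m) :
    (dimClass n V (chi0 n hn) : ℝ) = 1 / (8 * n) *
      (2 * n * m ^ n + n * m ^ (2 * n) + n * m ^ (2 * n + 2)
        + ∑ k ∈ Finset.range (4 * n), (m : ℝ) ^ Nat.gcd (4 * n) k) ∧
    (dimClass n V (chi1 n hn) : ℝ) = 1 / (8 * n) *
      (-(2 * n * m ^ n) - n * m ^ (2 * n) - n * m ^ (2 * n + 2)
        + ∑ k ∈ Finset.range (4 * n), (m : ℝ) ^ Nat.gcd (4 * n) k) ∧
    (dimClass n V (chi2 n hn) : ℝ) = 1 / (8 * n) *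
      (m ^ (4 * n) + m ^ (2 * n) - 2 * m ^ n
        + 2 * ∑ k ∈ CdagEven n, (m : ℝ) ^ Nat.gcd (4 * n) k
        - ∑ k ∈ CdagOdd n ∪ bar n (CdagOdd n), (m : ℝ) ^ Nat.gcd (4 * n) k
        - 2 * n * m ^ n + n * m ^ (2 * n) + n * m ^ (2 * n + 2)) ∧
    (dimClass n V (chi3 n hn) : ℝ) = 1 / (8 * n) *
      (m ^ (4 * n) + m ^ (2 * n) - 2 * m ^ n
        + 2 * ∑ k ∈ CdagEven n, (m : ℝ) ^ Nat.gcd (4 * n) k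
        - ∑ k ∈ CdagOdd n ∪ bar n (CdagOdd n), (m : ℝ) ^ Nat.gcd (4 * n) k
        + 2 * n * m ^ n - n * m ^ (2 * n) - n * m ^ (2 * n + 2)) ∧
    (dimClass n V (chi4 n hn) : ℝ) = 1 / (8 * n) *
      (m ^ (4 * n) - m ^ (2 * n)
        + ∑ k ∈ CdagEven n ∪ bar n (CdagEven n), (-1 : ℝ) ^ (k / 2) * (m : ℝ) ^ Nat.gcd (4 * n) k
        + n * m ^ (2 * n + 2) - n * m ^ (2 * n)) ∧
    (dimClass n V (chi5 n hn) : ℝ) = 1 / (8 * n) *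
      (m ^ (4 * n) - m ^ (2 * n)
        + ∑ k ∈ CdagEven n ∪ bar n (CdagEven n), (-1 : ℝ) ^ (k / 2) * (m : ℝ) ^ Nat.gcd (4 * n) k
        - n * m ^ (2 * n + 2) + n * m ^ (2 * n)) ∧
    (dimClass n V (chi6 n hn) : ℝ) = 1 / (8 * n) *
      (m ^ (4 * n) - m ^ (2 * n)
        + ∑ k ∈ CdagEven n ∪ bar n (CdagEven n), (-1 : ℝ) ^ (k / 2) * (m : ℝ) ^ Nat.gcd (4 * n) k
        + n * m ^ (2 * n + 2) - n * m ^ (2 * n)) ∧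
    (dimClass n V (chi7 n hn) : ℝ) = 1 / (8 * n) *
      (m ^ (4 * n) - m ^ (2 * n)
        + ∑ k ∈ CdagEven n ∪ bar n (CdagEven n), (-1 : ℝ) ^ (k / 2) * (m : ℝ) ^ Nat.gcd (4 * n) k
        - n * m ^ (2 * n + 2) + n * m ^ (2 * n)) ∧
    (∀ h ∈ CdagEven n,
      (dimClass n V (rhoChar n h) : ℝ) = 1 / (2 * n) *
        ∑ k ∈ Finset.range (4 * n),
          (m : ℝ) ^ Nat.gcd (4 * n) k * Real.cos (h * k * Real.pi / (2 * n))) ∧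
    (∀ h ∈ Codd23 n \ {n, 3 * n},
      (dimClass n V (rhoChar n h) : ℝ) = 1 / (4 * n) *
        (2 * m ^ (4 * n) - 2 * m ^ (2 * n)
          + 4 * ∑ k ∈ CdagEven n,
            (m : ℝ) ^ Nat.gcd (4 * n) k * Real.cos (h * k * Real.pi / (2 * n)))) := by
  have hI : (unitI : ℂ) ^ 2 = -1 := by simp [unitI]
  have hI' : ((-unitI : ℂˣ) : ℂ) ^ 2 = -1 := by simp [unitI]
  -- The formulas are available over `ℂ` and descend to `ℝ` by injectivity of the inclusion.
  refine ⟨?_, ?_, ?_, ?_, ?_, ?_, ?_, ?_, fun h hh => ?_, fun h hh => ?_⟩ <;>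
    apply Complex.ofReal_injective
  · rw [Complex.ofReal_natCast, chi0, dimClass_linChar_one n hn2 hn V m hm]
    push_cast
    ring
  · rw [Complex.ofReal_natCast, chi1, dimClass_linChar_one n hn2 hn V m hm]
    push_cast
    ring
  · rw [Complex.ofReal_natCast, chi2, dimClass_linChar_neg_one n hn2 hn V m hm]
    push_cast
    ring
  · rw [Complex.ofReal_natCast, chi3, dimClass_linChar_neg_one n hn2 hn V m hm]
    push_cast
    ring
  · rw [Complex.ofReal_natCast, chi4, dimClass_linChar_of_sq_eq_neg_one n hn2 hn V m hm _ _ _ hI]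
    push_cast
    ring
  · rw [Complex.ofReal_natCast, chi5, dimClass_linChar_of_sq_eq_neg_one n hn2 hn V m hm _ _ _ hI]
    push_cast
    ring
  · rw [Complex.ofReal_natCast, chi6, dimClass_linChar_of_sq_eq_neg_one n hn2 hn V m hm _ _ _ hI']
    push_cast
    ring
  · rw [Complex.ofReal_natCast, chi7, dimClass_linChar_of_sq_eq_neg_one n hn2 hn V m hm _ _ _ hI']
    push_cast
    ring
  · obtain ⟨he, h0, h1⟩ := mem_CdagEven.mp hh
    -- The only multiple of `n` strictly between 0 and `2n` is `n`, which is odd.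
    have hdvd : ¬ n ∣ h := by
      rintro ⟨c, rfl⟩
      have hc : c < 2 := by by_contra! hc; nlinarith
      have hc0 : c ≠ 0 := by rintro rfl; simp at h0
      obtain rfl : c = 1 := by omega
      rw [mul_one] at he
      exact Nat.not_even_iff_odd.mpr hn he
    rw [Complex.ofReal_natCast, dimClass_rhoChar_even n hn2 hn V m hm h hdvd he]
    push_cast
    rfl
  · simp only [Codd23, Finset.mem_sdiff, Finset.mem_filter, Finset.mem_union, Finset.mem_Icc,
      Finset.mem_insert, Finset.mem_singleton] at hh
    -- The odd multiples of `n` up to `3n` are `n` and `3n`, and both are excluded.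
    have hdvd : ¬ n ∣ h := by
      rintro ⟨c, rfl⟩
      have hc : c < 4 := by
        by_contra! hc
        have := Nat.mul_le_mul_left n hc
        omega
      interval_cases c <;> omega
    rw [Complex.ofReal_natCast, dimClass_rhoChar_odd n hn2 hn V m hm h hdvd hh.1.2]
    push_cast
    rfl
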